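/- Double-head pushdown automata. A (nondeterministic) double-head pushdown automaton (DHPDA) is a pushdown automaton with finitely many states, input letters and pushdown symbols whose input is read by two heads, a left one moving from the left end to the right and a right one moving from the right end to the left; the heads never pass each other. Configurations are triples $(q,w,s)$ with state $q$, unread input $w$ and pushdown content $s$ (initially empty). Depending on the state, the letters read by the heads (each head may also rest) and the topmost pushdown symbol (or the special symbol $\bot$ if the pushdown is empty), the automaton chooses one of finitely many moves, each of which changes the state and replaces the topmost symbol by a string. A word is accepted if some computation starting in the initial state with empty pushdown reads the whole word and ends in an accepting state. A nondeterministic input-driven double-head pushdown automaton (NIDDHPDA) moves exactly one head in every step, and its input alphabet is partitioned into sets $\Sigma_D,\Sigma_R,\Sigma_N$ (the same for both heads): on reading a letter of $\Sigma_D$ it pushes one symbol, on reading a letter of $\Sigma_R$ it pops the topmost symbol (the empty pushdown stays empty), and on reading a letter of $\Sigma_N$ it leaves the pushdown unchanged; the new state, and the symbol pushed if any, are chosen from a set that depends on the current state, the head moved, the letter read, and the topmost pushdown symbol (or $\bot$). It is deterministic (DIDDHPDA) if there is at most one choice of action in every configuration. For each type $X$ of automata let $\mathcal L(X)$ be the family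 of languages accepted by automata of type $X$. **Theorem.** Neither $\mathcal L(\mathrm{DIDDHPDA})$ nor $\mathcal L(\mathrm{NIDDHPDA})$ is closed under intersection. More precisely, the languages $$L=\{\,a^nb^nc^nd^me^\ell \mid m,n,\ell\ge 1\,\}\quad\text{and}\quad L'=\{\,a^mb^\ell c^nd^ne^n\mid m,n,\ell\ge 1\,\}$$ both belong to $\mathcal L(\mathrm{DIDDHPDA})$, whereas their intersection is $$L\cap L'=\{\,a^nb^nc^nd^ne^n\mid n\ge 1\,\},$$ which does not belong to $\mathcal L(\mathrm{DHPDA})$. -/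

import Mathlib

/-- The two input heads. The left head moves to the right, the right head moves to the left. -/
inductive Head where
  | left
  | right

/-- `Reads h w a w'`: on the unread input `w`, head `h` reads the letter `a` and leaves `w'`. -/
def Reads {α : Type} : Head → List α → α → List α → Prop
  | Head.left, w, a, w' => w = a :: w'
  | Head.right, w, a, w' => w = w' ++ [a]

/-- A configuration: the current state, the unread part of the input, and the pushdown content
(the head of the list is the top of the pushdown store). -/
structure Config (Q α Γ : Type) where
  state : Q
  input : List α
  stack : List Γ

/-- The three kinds of pushdown actions. -/
inductive PushdownAction where
  | push
  | pop
  | neutral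

/-- A nondeterministic input-driven double-head pushdown automaton with states `Q`, input
alphabet `α` and pushdown alphabet `Γ`.

The signature `sig` is the partition of the input alphabet into push letters, pop letters and
state-change letters; both heads obey it. Every transition moves exactly one head, so a pair of
arguments `(a, λ)` or `(λ, a)` is given by the head that moves and the letter `a` it reads.
The last argument is the topmost pushdown symbol, `none` being the empty pushdown symbol `⊥`.
An undefined transition is the empty set. -/
structure NIDDHPDA (Q α Γ : Type) where
  sig : α → PushdownAction
  start : Q
  accept : Set Q
  pushStep : Q → Head → {a : α // sig a = PushdownAction.push} → Option Γ → Set (Q × Γ)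
  popStep : Q → Head → {a : α // sig a = PushdownAction.pop} → Option Γ → Set Q
  neutralStep : Q → Head → {a : α // sig a = PushdownAction.neutral} → Option Γ → Set Q

namespace NIDDHPDA

/-- One step of the automaton in which head `h` is moved. Popping from the empty pushdown
store leaves it empty. -/
inductive Step {Q α Γ : Type} (M : NIDDHPDA Q α Γ) :
    Head → Config Q α Γ → Config Q α Γ → Prop where
  | push {h : Head} {q q' : Q} {a : α} {w w' : List α} {s : List Γ} {z : Γ}
      (hr : Reads h w a w') (ha : M.sig a = PushdownAction.push)
      (ht : (q', z) ∈ M.pushStep q h ⟨a, ha⟩ s.head?) :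
      Step M h ⟨q, w, s⟩ ⟨q', w', z :: s⟩
  | pop {h : Head} {q q' : Q} {a : α} {w w' : List α} {s : List Γ}
      (hr : Reads h w a w') (ha : M.sig a = PushdownAction.pop)
      (ht : q' ∈ M.popStep q h ⟨a, ha⟩ s.head?) :
      Step M h ⟨q, w, s⟩ ⟨q', w', s.tail⟩
  | neutral {h : Head} {q q' : Q} {a : α} {w w' : List α} {s : List Γ}
      (hr : Reads h w a w') (ha : M.sig a = PushdownAction.neutral)
      (ht : q' ∈ M.neutralStep q h ⟨a, ha⟩ s.head?) :
      Step M h ⟨q, w, s⟩ ⟨q', w', s⟩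

/-- The words on which some computation reads the whole input and ends in an accepting state. -/
def language {Q α Γ : Type} (M : NIDDHPDA Q α Γ) : Language α :=
  {w | ∃ q ∈ M.accept, ∃ s : List Γ,
    Relation.ReflTransGen (fun c c' => ∃ h, M.Step h c c') ⟨M.start, w, []⟩ ⟨q, [], s⟩}

/-- In every configuration there is at most one choice of action. Moving different heads counts
as different actions, even if the resulting configurations coincide. -/
def Deterministic {Q α Γ : Type} (M : NIDDHPDA Q α Γ) : Prop :=
  ∀ (c c₁ c₂ : Config Q α Γ) (h₁ h₂ : Head),
    M.Step h₁ c c₁ → M.Step h₂ c c₂ → h₁ = h₂ ∧ c₁ = c₂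

end NIDDHPDA

/-- A (nondeterministic, not necessarily input-driven) double-head pushdown automaton.
`δ q x y z` is the finite set of possible moves in state `q` when the left head reads `x`, the
right head reads `y` (`none` means that the head does not move) and `z` is the topmost pushdown
symbol (`none` if the pushdown store is empty). A move `(q', u)` enters state `q'` and replaces
the topmost pushdown symbol, if there is one, by the string `u`. -/
structure DHPDA (Q α Γ : Type) where
  start : Q
  accept : Set Q
  δ : Q → Option α → Option α → Option Γ → Set (Q × List Γ)
  finite_δ : ∀ q x y z, (δ q x y z).Finite

namespace DHPDA

/-- One step of the automaton. -/
inductive Step {Q α Γ : Type} (M : DHPDA Q α Γ) : Config Q α Γ → Config Q α Γ → Prop where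
  | mk {q q' : Q} {x y : Option α} {w : List α} {s u : List Γ}
      (ht : (q', u) ∈ M.δ q x y s.head?) :
      Step M ⟨q, x.toList ++ w ++ y.toList, s⟩ ⟨q', w, u ++ s.tail⟩

/-- The words on which some computation reads the whole input and ends in an accepting state. -/
def language {Q α Γ : Type} (M : DHPDA Q α Γ) : Language α :=
  {w | ∃ q ∈ M.accept, ∃ s : List Γ,
    Relation.ReflTransGen M.Step ⟨M.start, w, []⟩ ⟨q, [], s⟩}

end DHPDA

/-- A family of languages, over all alphabets. -/
abbrev LanguageFamily : Type 1 := ∀ α : Type, Set (Language α)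

/-- The family of languages accepted by nondeterministic input-driven double-head pushdown
automata (with finitely many states and pushdown symbols). -/
def familyNIDDHPDA : LanguageFamily := fun α =>
  {L | ∃ (Q Γ : Type) (_ : Finite Q) (_ : Finite Γ) (M : NIDDHPDA Q α Γ), M.language = L}

/-- The family of languages accepted by deterministic input-driven double-head pushdown
automata. -/
def familyDIDDHPDA : LanguageFamily := fun α =>
  {L | ∃ (Q Γ : Type) (_ : Finite Q) (_ : Finite Γ) (M : NIDDHPDA Q α Γ),
    M.Deterministic ∧ M.language = L}

/-- The family of languages accepted by nondeterministic double-head pushdown automata. -/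
def familyDHPDA : LanguageFamily := fun α =>
  {L | ∃ (Q Γ : Type) (_ : Finite Q) (_ : Finite Γ) (M : DHPDA Q α Γ), M.language = L}

/-- The intersection of any two languages of the family over a common finite alphabet belongs
to the family. -/
def ClosedUnderIntersection (F : LanguageFamily) : Prop :=
  ∀ (α : Type) [Finite α] (L₁ L₂ : Language α), L₁ ∈ F α → L₂ ∈ F α → L₁ ⊓ L₂ ∈ F α

/-- The alphabet `{a, b, c, d, e}`. -/
inductive Letter where
  | a
  | b
  | c
  | d
  | e
  deriving DecidableEq

instance : Finite Letter :=
  Finite.of_surjective (fun i : Fin 5 => match i with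
    | 0 => Letter.a | 1 => Letter.b | 2 => Letter.c | 3 => Letter.d | 4 => Letter.e)
    (fun x => by
      cases x
      · exact ⟨0, rfl⟩
      · exact ⟨1, rfl⟩
      · exact ⟨2, rfl⟩
      · exact ⟨3, rfl⟩
      · exact ⟨4, rfl⟩)

/-- The word `a^i b^j c^k d^m e^l`. -/
def blockWord (i j k m l : ℕ) : List Letter :=
  List.replicate i Letter.a ++ List.replicate j Letter.b ++ List.replicate k Letter.c ++
    List.replicate m Letter.d ++ List.replicate l Letter.e

/-- The language `{a^n b^n c^n d^m e^l | m, n, l ≥ 1}`. -/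
def langABC : Language Letter :=
  {w | ∃ n m l : ℕ, 1 ≤ n ∧ 1 ≤ m ∧ 1 ≤ l ∧ w = blockWord n n n m l}

/-- The language `{a^m b^l c^n d^n e^n | n, m, l ≥ 1}`. -/
def langCDE : Language Letter :=
  {w | ∃ n m l : ℕ, 1 ≤ n ∧ 1 ≤ m ∧ 1 ≤ l ∧ w = blockWord m l n n n}

/-- The language `{a^n b^n c^n d^n e^n | n ≥ 1}`. -/
def langABCDE : Language Letter :=
  {w | ∃ n : ℕ, 1 ≤ n ∧ w = blockWord n n n n n}

/-! Since the two input-driven families lie inside the DHPDA family, it suffices to put `langABC`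
and `langCDE` in the smallest family and keep `langABCDE` out of the largest.

For `langABC`, the letters `a` push and the letters `b` pop. The right head skips `e` and `d`. Then
the heads alternate, the right one reading a `c` and the left one pushing an `a`, so that these
numbers agree. Finally the right head matches each `b` with a stored symbol. `langCDE` is the mirror
image under the renaming `a ↔ e`, `b ↔ d`, and exchanging the heads preserves determinism.

For `langABCDE_notMem`, list the letters in the order in which the heads consume them. This gives a
word read by an ordinary pushdown automaton, and the input is its left-head part followed by the
reversal of its right-head part (`DHPDA.mem_language_iff`). Pumping down
(`Emptying.exists_shortens`) deletes letters inside a short factor of that word, hence inside two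
short factors of the input (`DHPDA.exists_pump_down`). In a word with five long blocks these factors
meet at most four blocks, so the fifth letter keeps its count while the length drops. -/

/-! ### Input-driven automata as general double-head pushdown automata -/

namespace NIDDHPDA

variable {Q α Γ : Type}

/-- The moves of `M` with head `h` on the letter `a`, as replacements of the topmost symbol. -/
def moves (M : NIDDHPDA Q α Γ) (q : Q) (h : Head) (a : α) (t : Option Γ) : Set (Q × List Γ) :=
  {m | (∃ ha z, (m.1, z) ∈ M.pushStep q h ⟨a, ha⟩ t ∧ m.2 = z :: t.toList) ∨
    (∃ ha, m.1 ∈ M.popStep q h ⟨a, ha⟩ t ∧ m.2 = []) ∨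
    (∃ ha, m.1 ∈ M.neutralStep q h ⟨a, ha⟩ t ∧ m.2 = t.toList)}

theorem finite_moves [Finite Q] [Finite Γ] (M : NIDDHPDA Q α Γ) (q : Q) (h : Head) (a : α)
    (t : Option Γ) : (M.moves q h a t).Finite := by
  -- A replacement string has at most two symbols: the old top and a pushed one.
  refine (Set.finite_univ.prod (List.finite_length_le Γ 2)).subset ?_
  rintro ⟨q', u⟩ hm
  have ht : t.toList.length ≤ 1 := by cases t <;> simp
  rcases hm with ⟨_, z, _, h⟩ | ⟨_, _, h⟩ | ⟨_, _, h⟩ <;> simp only at h <;> subst h <;>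
    (simp; try omega)

/-- An input-driven automaton, regarded as a double-head pushdown automaton. -/
def toDHPDA [Finite Q] [Finite Γ] (M : NIDDHPDA Q α Γ) : DHPDA Q α Γ where
  start := M.start
  accept := M.accept
  δ q x y t := match x, y with
    | some a, none => M.moves q Head.left a t
    | none, some a => M.moves q Head.right a t
    | _, _ => ∅
  finite_δ q x y t := by
    rcases x with _ | a <;> rcases y with _ | b
    · exact Set.finite_empty
    · exact M.finite_moves q _ b t
    · exact M.finite_moves q _ a t
    · exact Set.finite_empty

/-- Putting the topmost symbol back restores the store even when it is empty, so all three kinds of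
action fit the single rule `u ++ s.tail`. -/
theorem exists_step_iff (M : NIDDHPDA Q α Γ) {h : Head} {q q' : Q} {w w' : List α}
    {s s' : List Γ} : M.Step h ⟨q, w, s⟩ ⟨q', w', s'⟩ ↔
      ∃ a u, Reads h w a w' ∧ (q', u) ∈ M.moves q h a s.head? ∧ s' = u ++ s.tail := by
  have hst : s.head?.toList ++ s.tail = s := by cases s <;> rfl
  constructor
  · intro hs
    cases hs with
    | push hr ha ht =>
      exact ⟨_, _, hr, Or.inl ⟨ha, _, ht, rfl⟩, by simp [hst]⟩
    | pop hr ha ht => exact ⟨_, _, hr, Or.inr (Or.inl ⟨ha, ht, rfl⟩), rfl⟩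
    | neutral hr ha ht => exact ⟨_, _, hr, Or.inr (Or.inr ⟨ha, ht, rfl⟩), hst.symm⟩
  · rintro ⟨a, u, hr, hm, rfl⟩
    rcases hm with ⟨ha, z, ht, h⟩ | ⟨ha, ht, h⟩ | ⟨ha, ht, h⟩ <;> simp only at h <;> subst h
    · rw [List.cons_append, hst]
      exact Step.push hr ha ht
    · exact Step.pop hr ha ht
    · rw [hst]
      exact Step.neutral hr ha ht

theorem toDHPDA_step_iff [Finite Q] [Finite Γ] (M : NIDDHPDA Q α Γ) (c c' : Config Q α Γ) :
    M.toDHPDA.Step c c' ↔ ∃ h, M.Step h c c' := by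
  obtain ⟨q', w', s'⟩ := c'
  constructor
  · intro hs
    cases hs with
    | @mk q q' x y w s u ht =>
      rcases x with _ | a <;> rcases y with _ | b
      · exact ht.elim
      · exact ⟨Head.right, (M.exists_step_iff).2 ⟨b, u, by simp [Reads], ht, rfl⟩⟩
      · exact ⟨Head.left, (M.exists_step_iff).2 ⟨a, u, by simp [Reads], ht, rfl⟩⟩
      · exact ht.elim
  · obtain ⟨q, w, s⟩ := c
    rintro ⟨h, hs⟩
    obtain ⟨a, u, hr, hm, rfl⟩ := M.exists_step_iff.1 hs
    cases h with
    | left =>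
      cases hr
      simpa using DHPDA.Step.mk (M := M.toDHPDA) (x := some a) (y := none) (w := w') (s := s) hm
    | right =>
      cases hr
      simpa using DHPDA.Step.mk (M := M.toDHPDA) (x := none) (y := some a) (w := w') (s := s) hm

theorem toDHPDA_language [Finite Q] [Finite Γ] (M : NIDDHPDA Q α Γ) :
    M.toDHPDA.language = M.language := by
  have : M.toDHPDA.Step = fun c c' => ∃ h, M.Step h c c' := by
    funext c c'
    exact propext (M.toDHPDA_step_iff c c')
  ext w
  unfold DHPDA.language language
  rw [this]
  rfl

end NIDDHPDA

theorem familyDIDDHPDA_subset (α : Type) : familyDIDDHPDA α ⊆ familyNIDDHPDA α := by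
  rintro L ⟨Q, Γ, hQ, hΓ, M, -, hM⟩
  exact ⟨Q, Γ, hQ, hΓ, M, hM⟩

theorem familyNIDDHPDA_subset (α : Type) : familyNIDDHPDA α ⊆ familyDHPDA α := by
  rintro L ⟨Q, Γ, hQ, hΓ, M, hM⟩
  exact ⟨Q, Γ, hQ, hΓ, M.toDHPDA, M.toDHPDA_language.trans hM⟩

/-! ### Mirror images -/

/-- The other head. -/
def Head.swap : Head → Head
  | Head.left => Head.right
  | Head.right => Head.left

theorem Head.swap_swap (h : Head) : h.swap.swap = h := by
  cases h <;> rfl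

theorem Reads.mirror {α : Type} {h : Head} {w w' : List α} {a : α} (hr : Reads h w a w')
    (σ : α → α) : Reads h.swap (w.reverse.map σ) (σ a) (w'.reverse.map σ) := by
  cases h <;> cases hr <;> simp [Reads, Head.swap]

namespace NIDDHPDA

variable {Q α Γ : Type}

/-- The automaton with the roles of the heads exchanged and the letters renamed by `σ`. -/
def mirror (M : NIDDHPDA Q α Γ) (σ : α → α) : NIDDHPDA Q α Γ where
  sig a := M.sig (σ a)
  start := M.start
  accept := M.accept
  pushStep q h a t := M.pushStep q h.swap ⟨σ a.1, a.2⟩ t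
  popStep q h a t := M.popStep q h.swap ⟨σ a.1, a.2⟩ t
  neutralStep q h a t := M.neutralStep q h.swap ⟨σ a.1, a.2⟩ t

/-- The mirror image of a configuration. -/
def _root_.Config.mirror (c : Config Q α Γ) (σ : α → α) : Config Q α Γ :=
  ⟨c.state, c.input.reverse.map σ, c.stack⟩

theorem _root_.Config.mirror_mirror (c : Config Q α Γ) {σ : α → α}
    (hσ : Function.Involutive σ) : (c.mirror σ).mirror σ = c := by
  simp [Config.mirror, hσ.comp_self]

theorem Step.of_mirror {M : NIDDHPDA Q α Γ} {σ : α → α} {h : Head} {c c' : Config Q α Γ}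
    (hs : (M.mirror σ).Step h c c') : M.Step h.swap (c.mirror σ) (c'.mirror σ) := by
  cases hs with
  | push hr ha ht => exact Step.push (hr.mirror σ) ha ht
  | pop hr ha ht => exact Step.pop (hr.mirror σ) ha ht
  | neutral hr ha ht => exact Step.neutral (hr.mirror σ) ha ht

theorem mirror_mirror (M : NIDDHPDA Q α Γ) {σ : α → α} (hσ : Function.Involutive σ) :
    (M.mirror σ).mirror σ = M := by
  obtain ⟨sig, q₀, F, f, g, k⟩ := M
  have hsig : (fun a => sig (σ (σ a))) = sig := funext fun a => congrArg sig (hσ a)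
  simp only [mirror, Head.swap_swap, mk.injEq, true_and]
  -- The transition functions have types depending on the signature, and `sig ∘ σ ∘ σ` is only
  -- propositionally equal to `sig`; hence heterogeneous equality.
  refine ⟨hsig, ?_, ?_, ?_⟩ <;>
  · refine Function.hfunext rfl fun q q' hq => ?_
    cases hq
    refine Function.hfunext rfl fun h h' hh => ?_
    cases hh
    refine Function.hfunext (by simp only [hσ _]) fun a a' haa => ?_
    have : a.1 = a'.1 := by
      refine (Subtype.heq_iff_coe_eq fun x => ?_).1 haa
      rw [hσ x]
    obtain ⟨a, ha⟩ := a
    obtain ⟨a', ha'⟩ := a'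
    cases this
    simp only [hσ a, heq_eq_eq]

theorem mirror_deterministic {M : NIDDHPDA Q α Γ} {σ : α → α} (hσ : Function.Involutive σ)
    (hM : M.Deterministic) : (M.mirror σ).Deterministic := by
  intro c c₁ c₂ h₁ h₂ hs₁ hs₂
  obtain ⟨hh, hc⟩ := hM _ _ _ _ _ hs₁.of_mirror hs₂.of_mirror
  refine ⟨by simpa only [Head.swap_swap] using congrArg Head.swap hh, ?_⟩
  simpa only [Config.mirror_mirror _ hσ] using congrArg (fun c => Config.mirror c σ) hc

theorem reverse_map_mem_of_mem_mirror {M : NIDDHPDA Q α Γ} {σ : α → α} {w : List α}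
    (hw : w ∈ (M.mirror σ).language) : w.reverse.map σ ∈ M.language := by
  obtain ⟨q, hq, s, h⟩ := hw
  refine ⟨q, hq, s, ?_⟩
  have := h.lift (p := fun c c' => ∃ h, M.Step h c c') (fun c => c.mirror σ)
    (fun c c' ⟨h, hs⟩ => ⟨h.swap, hs.of_mirror⟩)
  simpa [Function.onFun, Config.mirror, NIDDHPDA.mirror] using this

theorem mem_mirror_language (M : NIDDHPDA Q α Γ) {σ : α → α} (hσ : Function.Involutive σ)
    (w : List α) : w ∈ (M.mirror σ).language ↔ w.reverse.map σ ∈ M.language := by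
  refine ⟨reverse_map_mem_of_mem_mirror, fun hw => ?_⟩
  rw [← M.mirror_mirror hσ] at hw
  simpa [hσ.comp_self] using reverse_map_mem_of_mem_mirror hw

end NIDDHPDA

/-! ### Pumping down for pushdown automata -/

/-- `Emptying Δ p s w q`: the pushdown automaton with transitions `Δ` can go from state `p` with
pushdown content `s` to state `q` with empty pushdown while reading `w`. The computation is
presented as a forest with one tree for each symbol of `s`. -/
inductive Emptying {Q Γ β : Type} (Δ : Q → Γ → List β → Q → List Γ → Prop) :
    Q → List Γ → List β → Q → Prop where
  | nil (p : Q) : Emptying Δ p [] [] p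
  | cons {p p' r q : Q} {Z : Γ} {u s : List Γ} {m w₁ w₂ : List β} (hΔ : Δ p Z m p' u)
      (h₁ : Emptying Δ p' u w₁ r) (h₂ : Emptying Δ r s w₂ q) :
      Emptying Δ p (Z :: s) (m ++ w₁ ++ w₂) q

namespace Emptying

variable {Q Γ β : Type} {Δ : Q → Γ → List β → Q → List Γ → Prop}

theorem append {p r q : Q} {s t : List Γ} {w₁ w₂ : List β} (h₁ : Emptying Δ p s w₁ r)
    (h₂ : Emptying Δ r t w₂ q) : Emptying Δ p (s ++ t) (w₁ ++ w₂) q := by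
  induction h₁ with
  | nil p => exact h₂
  | cons hΔ h _ _ ih =>
    have := cons hΔ h (ih h₂)
    simpa only [List.append_assoc, List.cons_append] using this

theorem exists_of_append {p q : Q} {s t : List Γ} {w : List β}
    (h : Emptying Δ p (s ++ t) w q) :
    ∃ r w₁ w₂, w = w₁ ++ w₂ ∧ Emptying Δ p s w₁ r ∧ Emptying Δ r t w₂ q := by
  induction s generalizing p w with
  | nil => exact ⟨p, [], w, rfl, nil p, h⟩
  | cons Z s ih =>
    cases h with
    | cons hΔ h₁ h₂ =>
      obtain ⟨r, v₁, v₂, rfl, h₃, h₄⟩ := ih h₂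
      exact ⟨r, _, v₂, by simp only [List.append_assoc], cons hΔ h₁ h₃, h₄⟩

/-- Translates a single move into the forest form: the forest for `u ++ s` is cut where `u` has been
used up. -/
theorem step {p p' q : Q} {Z : Γ} {u s : List Γ} {m w : List β} (hΔ : Δ p Z m p' u)
    (h : Emptying Δ p' (u ++ s) w q) : Emptying Δ p (Z :: s) (m ++ w) q := by
  obtain ⟨r, w₁, w₂, rfl, h₁, h₂⟩ := exists_of_append h
  simpa only [List.append_assoc] using cons hΔ h₁ h₂

/-- Induction along the steps of a computation. -/
theorem step_induction {q : Q} {motive : Q → List Γ → List β → Prop} (nil : motive q [] [])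
    (step : ∀ {p p' : Q} {Z : Γ} {u s : List Γ} {m w : List β}, Δ p Z m p' u →
      motive p' (u ++ s) w → motive p (Z :: s) (m ++ w))
    {p : Q} {s : List Γ} {w : List β} (h : Emptying Δ p s w q) : motive p s w := by
  -- The store `t` below `s` serves as a continuation, so that the trees of a forest can be
  -- processed one after another.
  suffices H : ∀ {p r : Q} {s : List Γ} {w : List β}, Emptying Δ p s w r →
      ∀ t v, motive r t v → motive p (s ++ t) (w ++ v) by
    simpa using H h [] [] nil
  intro p r s w h
  induction h with
  | nil p => exact fun t v h => h
  | cons hΔ _ _ ih₁ ih₂ =>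
    intro t v htv
    have := step hΔ (ih₁ _ _ (ih₂ t v htv))
    simpa only [List.append_assoc, List.cons_append] using this

/-- A long computation contains the complete processing of a single pushdown symbol
whose input length lies in a prescribed window. -/
theorem exists_window {c b : ℕ} (hc : ∀ {p Z m p' u}, Δ p Z m p' u → m.length ≤ c)
    (hb : ∀ {p Z m p' u}, Δ p Z m p' u → u.length ≤ b) (t : ℕ) {p q : Q} {s : List Γ}
    {w : List β} (h : Emptying Δ p s w q) (hw : s.length * t < w.length) :
    ∃ (p' : Q) (Z : Γ) (q' : Q) (u x z : List β), w = u ++ x ++ z ∧ t < x.length ∧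
      x.length ≤ c + b * t ∧ Emptying Δ p' [Z] x q' ∧
      ∀ x', Emptying Δ p' [Z] x' q' → Emptying Δ p s (u ++ x' ++ z) q := by
  induction h with
  | nil p => simp at hw
  | @cons p p' r q Z v s m w₁ w₂ hΔ h₁ h₂ ih₁ ih₂ =>
    -- Descend into any subforest that reads more than `t` letters per symbol. If neither does, the
    -- tree of `Z` itself is the window: its siblings are too short to account for the excess, and
    -- its children read at most `b * t` letters.
    by_cases hw₁ : v.length * t < w₁.length
    · obtain ⟨p₁, Z₁, q₁, u, x, z, rfl, h3, h4, h5, h6⟩ := ih₁ hw₁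
      refine ⟨p₁, Z₁, q₁, m ++ u, x, z ++ w₂, by simp only [List.append_assoc], h3, h4, h5,
        fun x' hx' => ?_⟩
      simpa only [List.append_assoc] using cons hΔ (h6 x' hx') h₂
    by_cases hw₂ : s.length * t < w₂.length
    · obtain ⟨p₁, Z₁, q₁, u, x, z, rfl, h3, h4, h5, h6⟩ := ih₂ hw₂
      refine ⟨p₁, Z₁, q₁, m ++ w₁ ++ u, x, z, by simp only [List.append_assoc], h3, h4, h5,
        fun x' hx' => ?_⟩
      simpa only [List.append_assoc] using cons hΔ h₁ (h6 x' hx')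
    refine ⟨p, Z, r, [], m ++ w₁, w₂, rfl, ?_, ?_, ?_, fun x' hx' => hx'.append h₂⟩
    · simp only [List.length_cons, List.length_append, Nat.succ_mul] at hw ⊢
      omega
    · have h3 := hc hΔ
      have h4 := Nat.mul_le_mul_right t (hb hΔ)
      simp only [List.length_append]
      omega
    · simpa using cons hΔ h₁ (nil r)

/-- The bounds of the successive windows. -/
def windowBound (c b : ℕ) : ℕ → ℕ
  | 0 => 0
  | k + 1 => c + b * windowBound c b k

theorem windowBound_le_succ (c b k : ℕ) : windowBound c b k ≤ windowBound c b (k + 1) := by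
  induction k with
  | zero => exact Nat.zero_le _
  | succ k ih => exact Nat.add_le_add_left (Nat.mul_le_mul_left b ih) c

/-- The word `w` can be shortened, within a factor of length at most `K`, to another word which
empties the pushdown in the same way. -/
def Shortens (Δ : Q → Γ → List β → Q → List Γ → Prop) (K : ℕ) (p : Q) (s : List Γ)
    (w : List β) (q : Q) : Prop :=
  ∃ u v x y z, w = u ++ v ++ x ++ y ++ z ∧ (v ++ x ++ y).length ≤ K ∧ 0 < (v ++ y).length ∧
    Emptying Δ p s (u ++ x ++ z) q

/-- Pigeonhole on nested windows: `F` collects the triples (state, symbol, state) of the outer ones.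
Once a triple repeats, the inner computation replaces the outer one, deleting `v` and `y`. `k`
bounds the number of further windows needed, each supplied by `exists_window`. -/
theorem shortens_of_chain {c b : ℕ} (hc : ∀ {p Z m p' u}, Δ p Z m p' u → m.length ≤ c)
    (hb : ∀ {p Z m p' u}, Δ p Z m p' u → u.length ≤ b) [Fintype Q] [Fintype Γ] {K : ℕ}
    {p q : Q} {s : List Γ} {w : List β} (k : ℕ) :
    ∀ (F : Finset (Q × Γ × Q)) (A : Q × Γ × Q) (u x z : List β),
      Fintype.card (Q × Γ × Q) ≤ F.card + k → w = u ++ x ++ z → x.length ≤ K →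
      windowBound c b k < x.length → Emptying Δ A.1 [A.2.1] x A.2.2 →
      (∀ x', Emptying Δ A.1 [A.2.1] x' A.2.2 → Emptying Δ p s (u ++ x' ++ z) q) →
      (∀ B ∈ F, ∃ u₁ v y z₁, u = u₁ ++ v ∧ z = y ++ z₁ ∧ (v ++ x ++ y).length ≤ K ∧
        0 < (v ++ y).length ∧
        ∀ x', Emptying Δ B.1 [B.2.1] x' B.2.2 → Emptying Δ p s (u₁ ++ x' ++ z₁) q) →
      Shortens Δ K p s w q := by
  classical
  induction k with
  | zero =>
    intro F A u x z hF hw hxK hx hA hctx hF'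
    have : A ∈ F := by
      rw [(Finset.card_eq_iff_eq_univ F).1 (le_antisymm (Finset.card_le_univ F) hF)]
      exact Finset.mem_univ A
    obtain ⟨u₁, v, y, z₁, rfl, rfl, h1, h2, h3⟩ := hF' A this
    exact ⟨u₁, v, x, y, z₁, by simpa only [List.append_assoc] using hw, h1, h2, h3 x hA⟩
  | succ k ih =>
    intro F A u x z hF hw hxK hx hA hctx hF'
    by_cases hAF : A ∈ F
    · obtain ⟨u₁, v, y, z₁, rfl, rfl, h1, h2, h3⟩ := hF' A hAF
      exact ⟨u₁, v, x, y, z₁, by simpa only [List.append_assoc] using hw, h1, h2, h3 x hA⟩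
    have hx' := (windowBound_le_succ c b k).trans_lt hx
    obtain ⟨p', Z, q', u', x', z', rfl, h1, h2, h3, h4⟩ :=
      exists_window hc hb (windowBound c b k) hA (by simpa using hx')
    -- Each new window is strictly shorter, so a repetition deletes at least one letter.
    have hlt : x'.length < (u' ++ x' ++ z').length := lt_of_le_of_lt h2 hx
    simp only [List.length_append] at hlt hxK
    refine ih (insert A F) (p', Z, q') (u ++ u') x' (z' ++ z) ?_ ?_ ?_ h1 h3 ?_ ?_
    · rw [Finset.card_insert_of_notMem hAF]
      omega
    · simpa only [List.append_assoc] using hw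
    · omega
    · intro x₁ hx₁
      simpa only [List.append_assoc] using hctx _ (h4 x₁ hx₁)
    · intro B hB
      rcases Finset.mem_insert.1 hB with rfl | hB
      · refine ⟨u, u', z', z, rfl, rfl, ?_, ?_, hctx⟩ <;>
          simp only [List.length_append] <;> omega
      · obtain ⟨u₁, v, y, z₁, rfl, rfl, h5, h6, h7⟩ := hF' B hB
        simp only [List.length_append] at h5 h6
        refine ⟨u₁, v ++ u', z' ++ y, z₁, by simp, by simp, ?_, ?_, h7⟩ <;>
          simp only [List.length_append] <;> omega

/-- Pumping down: every long input can be shortened within a factor of bounded length. -/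
theorem exists_shortens [Finite Q] [Finite Γ] {c b : ℕ}
    (hc : ∀ {p Z m p' u}, Δ p Z m p' u → m.length ≤ c)
    (hb : ∀ {p Z m p' u}, Δ p Z m p' u → u.length ≤ b) :
    ∃ K, ∀ {p Z q w}, Emptying Δ p [Z] w q → K < w.length → Shortens Δ K p [Z] w q := by
  have := Fintype.ofFinite Q
  have := Fintype.ofFinite Γ
  set N := Fintype.card (Q × Γ × Q)
  refine ⟨windowBound c b (N + 1), fun {p Z q w} h hw => ?_⟩
  have hw' := (windowBound_le_succ c b N).trans_lt hw
  obtain ⟨p', Z', q', u, x, z, rfl, h1, h2, h3, h4⟩ :=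
    exists_window hc hb (windowBound c b N) h (by simpa using hw')
  exact shortens_of_chain hc hb N ∅ (p', Z', q') u x z (by simp [N]) rfl h2 h1 h3 h4 (by simp)

end Emptying

/-! ### The automaton for `langABC` -/

namespace ABC

/-- The letters `a` are pushed and the letters `b` are popped. -/
def sig : Letter → PushdownAction
  | Letter.a => PushdownAction.push
  | Letter.b => PushdownAction.pop
  | _ => PushdownAction.neutral

/-- The moves of the right head on the letters `c`, `d`, `e`. -/
def next : Fin 7 → Letter → Option (Fin 7)
  | 0, Letter.e => some 1
  | 1, Letter.e => some 1
  | 1, Letter.d => some 2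
  | 2, Letter.d => some 2
  | 2, Letter.c => some 3
  | 4, Letter.c => some 3
  | _, _ => none

/-- The head that moves next. -/
def head (q : Fin 7) : Head := if q = 3 then Head.left else Head.right

/-- The right head skips the letters `e` and `d` (states 0, 1, 2). Then one `c` and one `a`
are read alternately (states 3, 4), and finally the letters `b` are matched with the pushdown
content (state 5). The first pushed symbol is `true`, so that popping it leads to the accepting
state 6. -/
def automaton : NIDDHPDA (Fin 7) Letter Bool where
  sig := sig
  start := 0
  accept := {6}
  pushStep q h _ t := {m | q = 3 ∧ h = head q ∧ m = (4, t.isNone)}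
  popStep q h _ t := {q' | (q = 4 ∨ q = 5) ∧ h = head q ∧ ∃ z, t = some z ∧
    q' = if z then 6 else 5}
  neutralStep q h a _ := {q' | h = head q ∧ next q a.1 = some q'}

/-- The state fixes the head, the head fixes the letter, the letter fixes the kind of action, and
each transition set has at most one element. -/
theorem automaton_deterministic : automaton.Deterministic := by
  have hread : ∀ {h : Head} {w w₁ w₂ : List Letter} {x y : Letter}, Reads h w x w₁ →
      Reads h w y w₂ → x = y ∧ w₁ = w₂ := by
    intro h w w₁ w₂ x y h₁ h₂
    cases h
    · cases h₁
      simpa [Reads] using h₂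
    · cases h₁
      have := List.append_inj' h₂ rfl
      exact ⟨by simpa using this.2, this.1⟩
  intro c c₁ c₂ h₁ h₂ hs₁ hs₂
  have hh : ∀ {c c' : Config (Fin 7) Letter Bool} {h : Head}, automaton.Step h c c' →
      h = head c.state := by
    intro c c' h hs
    cases hs with
    | push _ _ ht => exact ht.2.1
    | pop _ _ ht => exact ht.2.1
    | neutral _ _ ht => exact ht.1
  have h12 : h₁ = h₂ := (hh hs₁).trans (hh hs₂).symm
  subst h12
  refine ⟨rfl, ?_⟩
  cases hs₁ with
  | push hr ha ht =>
    cases hs₂ with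
    | push hr' ha' ht' =>
      obtain ⟨rfl, rfl⟩ := hread hr hr'
      have := ht.2.2.trans ht'.2.2.symm
      simp_all
    | pop hr' ha' ht' | neutral hr' ha' ht' =>
      obtain ⟨rfl, rfl⟩ := hread hr hr'
      simp [ha] at ha'
  | pop hr ha ht =>
    cases hs₂ with
    | pop hr' ha' ht' =>
      obtain ⟨rfl, rfl⟩ := hread hr hr'
      obtain ⟨-, -, z, hz, rfl⟩ := ht
      obtain ⟨-, -, z', hz', rfl⟩ := ht'
      simp_all
    | push hr' ha' ht' | neutral hr' ha' ht' =>
      obtain ⟨rfl, rfl⟩ := hread hr hr'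
      simp [ha] at ha'
  | neutral hr ha ht =>
    cases hs₂ with
    | neutral hr' ha' ht' =>
      obtain ⟨rfl, rfl⟩ := hread hr hr'
      have := ht.2.symm.trans ht'.2
      simp_all
    | push hr' ha' ht' | pop hr' ha' ht' =>
      obtain ⟨rfl, rfl⟩ := hread hr hr'
      simp [ha] at ha'

/-- The pushdown content of height `k`. -/
def stack : ℕ → List Bool
  | 0 => []
  | k + 1 => if k = 0 then [true] else false :: stack k

/-- The pushed symbol is `t.isNone`, so a push turns the store of height `k` into that of height `k
+ 1`. -/
theorem stack_succ (k : ℕ) : stack (k + 1) = (stack k).head?.isNone :: stack k := by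
  cases k with
  | zero => rfl
  | succ k => rw [stack]; simp; cases k <;> simp [stack]

/-- The words accepted from the given state with pushdown content of height `k`. -/
def Good (q : Fin 7) (w : List Letter) (k : ℕ) : Prop :=
  match q with
  | 0 => ∃ i m l, w = blockWord (i + 1) (i + 1) (i + 1) (m + 1) (l + 1)
  | 1 => ∃ i m l, w = blockWord (i + 1) (i + 1) (i + 1) (m + 1) l
  | 2 => ∃ i m, w = blockWord (i + 1) (i + 1) (i + 1) m 0
  | 3 => ∃ i, w = blockWord (i + 1) (i + 1 + k) i 0 0
  | 4 => ∃ i, w = blockWord i (i + k) i 0 0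
  | 5 => w = blockWord 0 k 0 0 0
  | 6 => w = []

theorem blockWord_snoc_e (i j k m l : ℕ) :
    blockWord i j k m l ++ [Letter.e] = blockWord i j k m (l + 1) := by
  simp [blockWord, List.replicate_succ']

theorem blockWord_snoc_d (i j k m : ℕ) :
    blockWord i j k m 0 ++ [Letter.d] = blockWord i j k (m + 1) 0 := by
  simp [blockWord, List.replicate_succ']

theorem blockWord_snoc_c (i j k : ℕ) :
    blockWord i j k 0 0 ++ [Letter.c] = blockWord i j (k + 1) 0 0 := by
  simp [blockWord, List.replicate_succ']

theorem blockWord_snoc_b (i j : ℕ) :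
    blockWord i j 0 0 0 ++ [Letter.b] = blockWord i (j + 1) 0 0 0 := by
  simp [blockWord, List.replicate_succ']

theorem a_cons_blockWord (i j k m l : ℕ) :
    Letter.a :: blockWord i j k m l = blockWord (i + 1) j k m l := by
  simp [blockWord, List.replicate_succ]

/-- Some computation from the given configuration reads the whole input and accepts. -/
def Accepts (q : Fin 7) (w : List Letter) (s : List Bool) : Prop :=
  ∃ s', Relation.ReflTransGen (fun c c' => ∃ h, automaton.Step h c c') ⟨q, w, s⟩ ⟨6, [], s'⟩

theorem Accepts.of_step {h : Head} {q q' : Fin 7} {w w' : List Letter} {s s' : List Bool}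
    (hs : automaton.Step h ⟨q, w, s⟩ ⟨q', w', s'⟩) (hacc : Accepts q' w' s') :
    Accepts q w s := by
  obtain ⟨t, ht⟩ := hacc
  exact ⟨t, ht.head ⟨h, hs⟩⟩

theorem Accepts.of_next {q q' : Fin 7} {x : Letter} {w : List Letter} {s : List Bool}
    (hx : sig x = PushdownAction.neutral) (hn : next q x = some q') (hq : head q = Head.right)
    (hacc : Accepts q' w s) : Accepts q (w ++ [x]) s :=
  hacc.of_step (NIDDHPDA.Step.neutral (h := Head.right) rfl hx ⟨hq.symm, hn⟩)

/-- State 4 is included because the first `b` is read there: a `b` instead of a `c` under the right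
head ends the alternation. -/
theorem accepts_five (k : ℕ) {q : Fin 7} (hq : q = 4 ∨ q = 5) :
    Accepts q (blockWord 0 (k + 1) 0 0 0) (stack (k + 1)) := by
  induction k generalizing q with
  | zero =>
    refine Accepts.of_step (h := Head.right) (q' := 6) (w' := []) (s' := []) ?_ ⟨[], .refl⟩
    exact NIDDHPDA.Step.pop (h := Head.right) (a := Letter.b) rfl rfl
      ⟨hq, by rcases hq with rfl | rfl <;> rfl, true, rfl, rfl⟩
  | succ k ih =>
    refine Accepts.of_step (h := Head.right) (q' := 5) ?_ (ih (Or.inr rfl))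
    rw [← blockWord_snoc_b]
    exact NIDDHPDA.Step.pop (h := Head.right) (a := Letter.b) (s := stack (k + 2)) rfl rfl
      ⟨hq, by rcases hq with rfl | rfl <;> rfl, false, rfl, rfl⟩

/-- The letters `b` balance the stored symbols together with the letters `a` still to be pushed. -/
theorem accepts_four (i k : ℕ) :
    Accepts 4 (blockWord i (i + k + 1) i 0 0) (stack (k + 1)) := by
  induction i generalizing k with
  | zero => simpa using accepts_five k (Or.inl rfl)
  | succ i ih =>
    rw [← blockWord_snoc_c]
    refine Accepts.of_next (q' := 3) rfl rfl rfl ?_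
    rw [← a_cons_blockWord]
    have := ih (k + 1)
    rw [stack_succ (k + 1)] at this
    refine Accepts.of_step (h := Head.left) (NIDDHPDA.Step.push rfl rfl ⟨rfl, rfl, rfl⟩) ?_
    rwa [show i + 1 + k + 1 = i + (k + 1) + 1 by omega]

/-- In state 1 no `d` has been read yet, so one must remain; in state 2 the letters `d` may be
exhausted. -/
theorem accepts_two (i m : ℕ) {q : Fin 7} (hq : q = 1 ∧ 0 < m ∨ q = 2) :
    Accepts q (blockWord (i + 1) (i + 1) (i + 1) m 0) [] := by
  induction m generalizing q with
  | zero =>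
    obtain rfl : q = 2 := by simpa using hq
    rw [← blockWord_snoc_c]
    refine Accepts.of_next (q' := 3) rfl rfl rfl ?_
    rw [← a_cons_blockWord]
    refine Accepts.of_step (h := Head.left) (NIDDHPDA.Step.push rfl rfl ⟨rfl, rfl, rfl⟩) ?_
    exact accepts_four i 0
  | succ m ih =>
    rw [← blockWord_snoc_d]
    refine Accepts.of_next (q' := 2) rfl ?_ ?_ (ih (Or.inr rfl)) <;>
      rcases hq with ⟨rfl, -⟩ | rfl <;> rfl

theorem accepts_one (i m l : ℕ) :
    Accepts 1 (blockWord (i + 1) (i + 1) (i + 1) (m + 1) l) [] := by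
  induction l with
  | zero => exact accepts_two i (m + 1) (Or.inl ⟨rfl, Nat.succ_pos m⟩)
  | succ l ih =>
    rw [← blockWord_snoc_e]
    exact Accepts.of_next rfl rfl rfl ih

/-- The heights of the pushdown content that can occur in the given state. -/
def Admissible (q : Fin 7) (k : ℕ) : Prop :=
  if q = 4 ∨ q = 5 then 0 < k else q = 3 ∨ k = 0

theorem good_of_next {q q' : Fin 7} {x : Letter} {w : List Letter} {k : ℕ}
    (hx : next q x = some q') (hk : Admissible q k) (hw : Admissible q' k → Good q' w k) :
    Good q (w ++ [x]) k := by
  unfold next at hx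
  split at hx
  · cases hx
    obtain ⟨i, m, l, rfl⟩ := hw (by simpa [Admissible] using hk)
    exact ⟨i, m, l, blockWord_snoc_e _ _ _ _ _⟩
  · cases hx
    obtain ⟨i, m, l, rfl⟩ := hw (by simpa [Admissible] using hk)
    exact ⟨i, m, l + 1, blockWord_snoc_e _ _ _ _ _⟩
  · cases hx
    obtain ⟨i, m, rfl⟩ := hw (by simpa [Admissible] using hk)
    exact ⟨i, m, 0, blockWord_snoc_d _ _ _ _⟩
  · cases hx
    obtain ⟨i, m, rfl⟩ := hw (by simpa [Admissible] using hk)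
    exact ⟨i, m + 1, blockWord_snoc_d _ _ _ _⟩
  · cases hx
    -- The alternation starts from an empty store; otherwise there would be `k` surplus letters `b`.
    obtain rfl : k = 0 := by simpa [Admissible] using hk
    obtain ⟨i, rfl⟩ := hw (by simp [Admissible])
    exact ⟨i, 0, blockWord_snoc_c _ _ _⟩
  · cases hx
    obtain ⟨i, rfl⟩ := hw (by simp [Admissible])
    exact ⟨i + 1, blockWord_snoc_c _ _ _⟩
  · cases hx

/-- For `k = 0` the bottom symbol `true` is popped, which leads to state 6, where nothing more can
be read. -/
theorem good_of_pop {q : Fin 7} {w : List Letter} {k : ℕ} (hq : q = 4 ∨ q = 5)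
    (hw : if k = 0 then w = [] else w = blockWord 0 k 0 0 0) :
    Good q (w ++ [Letter.b]) (k + 1) := by
  have : w = blockWord 0 k 0 0 0 := by
    split_ifs at hw with hk
    · simp [hw, hk, blockWord]
    · exact hw
  subst this
  rw [blockWord_snoc_b]
  rcases hq with rfl | rfl
  · exact ⟨0, by simp⟩
  · rfl

/-- Induction backwards from the accepting configuration: each move prepends or appends the letter
it reads to a word already known to be good. -/
theorem good_of_accepts {q : Fin 7} {w : List Letter} {k : ℕ} (hk : Admissible q k)
    (h : Accepts q w (stack k)) : Good q w k := by
  obtain ⟨s', h⟩ := h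
  suffices H : ∀ c : Config (Fin 7) Letter Bool,
      Relation.ReflTransGen (fun c c' => ∃ h, automaton.Step h c c') c ⟨6, [], s'⟩ →
      ∀ k, c.stack = stack k → Admissible c.state k → Good c.state c.input k from
    H _ h k rfl hk
  intro c hc
  induction hc using Relation.ReflTransGen.head_induction_on with
  | refl => exact fun _ _ _ => rfl
  | head hs _ ih =>
    obtain ⟨h, hs⟩ := hs
    intro k hck hk
    cases hs with
    | @push q q' x w w' s z hr ha ht =>
      obtain ⟨rfl, rfl, ht⟩ := ht
      obtain ⟨rfl, rfl⟩ := Prod.mk.inj ht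
      cases hr
      simp only at hck
      subst hck
      cases x <;> try cases ha
      obtain ⟨i, hi⟩ := ih (k + 1) (stack_succ k).symm (by simp [Admissible])
      simp only at hi
      subst hi
      refine ⟨i, ?_⟩
      simp only [a_cons_blockWord]
      congr 1
      omega
    | @pop q q' x w w' s hr ha ht =>
      obtain ⟨hq, rfl, z, hz, rfl⟩ := ht
      have hhead : head q = Head.right := by rcases hq with rfl | rfl <;> rfl
      rw [hhead] at hr
      cases hr
      simp only at hck
      subst hck
      cases x <;> try cases ha
      have hk0 : 0 < k := by simpa only [Admissible, if_pos hq] using hk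
      obtain ⟨k, rfl⟩ := Nat.exists_eq_succ_of_ne_zero hk0.ne'
      refine good_of_pop hq ?_
      have h := ih k
      simp only [Nat.succ_eq_add_one, stack_succ, List.tail_cons, List.head?_cons,
        Option.some.injEq] at h hz
      subst hz
      rcases k with _ | k
      · exact h trivial (by simp [stack, Admissible])
      · rw [stack_succ k] at h
        exact h trivial (by simp [Admissible])
    | @neutral q q' x w w' s hr ha ht =>
      obtain ⟨rfl, hn⟩ := ht
      have hhead : head q = Head.right := by
        unfold head
        split_ifs with h3
        · subst h3
          cases x <;> cases hn
        · rfl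
      rw [hhead] at hr
      cases hr
      exact good_of_next hn hk (ih k hck)

theorem automaton_language : automaton.language = langABC := by
  ext w
  constructor
  · rintro ⟨q, rfl, s, h⟩
    obtain ⟨i, m, l, rfl⟩ := good_of_accepts (q := 0) (k := 0) (by simp [Admissible]) ⟨s, h⟩
    exact ⟨i + 1, m + 1, l + 1, by omega, by omega, by omega, rfl⟩
  · rintro ⟨n, m, l, hn, hm, hl, rfl⟩
    obtain ⟨n, rfl⟩ := Nat.exists_eq_add_of_le' hn
    obtain ⟨m, rfl⟩ := Nat.exists_eq_add_of_le' hm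
    obtain ⟨l, rfl⟩ := Nat.exists_eq_add_of_le' hl
    rw [← blockWord_snoc_e]
    obtain ⟨s, h⟩ := Accepts.of_next (q := 0) (x := Letter.e) rfl rfl rfl
      (accepts_one n m l)
    exact ⟨6, rfl, s, h⟩

end ABC

theorem langABC_mem : langABC ∈ familyDIDDHPDA Letter :=
  ⟨Fin 7, Bool, inferInstance, inferInstance, ABC.automaton, ABC.automaton_deterministic,
    ABC.automaton_language⟩

/-! ### The mirrored language and the intersection -/

/-- The renaming of the letters that reverses their order. -/
def Letter.mirror : Letter → Letter
  | Letter.a => Letter.e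
  | Letter.b => Letter.d
  | Letter.c => Letter.c
  | Letter.d => Letter.b
  | Letter.e => Letter.a

theorem Letter.mirror_involutive : Function.Involutive Letter.mirror := by
  intro x
  cases x <;> rfl

theorem blockWord_mirror (i j k m l : ℕ) :
    (blockWord i j k m l).reverse.map Letter.mirror = blockWord l m k j i := by
  simp [blockWord, Letter.mirror]

theorem langCDE_mem : langCDE ∈ familyDIDDHPDA Letter := by
  refine ⟨Fin 7, Bool, inferInstance, inferInstance, ABC.automaton.mirror Letter.mirror,
    NIDDHPDA.mirror_deterministic Letter.mirror_involutive ABC.automaton_deterministic, ?_⟩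
  ext w
  rw [NIDDHPDA.mem_mirror_language _ Letter.mirror_involutive, ABC.automaton_language]
  constructor
  · rintro ⟨n, m, l, hn, hm, hl, h⟩
    refine ⟨n, l, m, hn, hl, hm, ?_⟩
    rw [← blockWord_mirror, ← h]
    simp [Letter.mirror_involutive.comp_self]
  · rintro ⟨n, m, l, hn, hm, hl, rfl⟩
    exact ⟨n, l, m, hn, hl, hm, blockWord_mirror _ _ _ _ _⟩

theorem blockWord_count (i j k m l : ℕ) (x : Letter) : (blockWord i j k m l).count x =
    match x with
    | Letter.a => i
    | Letter.b => j
    | Letter.c => k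
    | Letter.d => m
    | Letter.e => l := by
  cases x <;> simp [blockWord, List.count_replicate]

theorem langABC_inf_langCDE : langABC ⊓ langCDE = langABCDE := by
  ext w
  constructor
  · rintro ⟨⟨n, m, l, hn, -, -, rfl⟩, ⟨n', m', l', -, -, -, h⟩⟩
    have hc := fun x => congrArg (List.count x) h
    simp only [blockWord_count] at hc
    have h1 := hc Letter.c
    have h2 := hc Letter.d
    have h3 := hc Letter.e
    simp only at h1 h2 h3
    subst h1 h2 h3
    exact ⟨_, hn, rfl⟩
  · rintro ⟨n, hn, rfl⟩
    exact ⟨⟨n, n, n, hn, hn, hn, rfl⟩, ⟨n, n, n, hn, hn, hn, rfl⟩⟩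

/-! ### Linearizing double-head computations -/

namespace DHPDA

variable {Q α Γ : Type}

/-- The computations of a double-head pushdown automaton as computations of a pushdown automaton
that reads the letters in the order in which the heads consume them. The bottom of the
pushdown is marked by `none`, and in accepting states the automaton may enter the
state `none`, in which it empties the pushdown. -/
inductive Linearized (M : DHPDA Q α Γ) :
    Option Q → Option Γ → List (α ⊕ α) → Option Q → List (Option Γ) → Prop where
  | move {q q' : Q} {x y : Option α} {t : Option Γ} {u : List Γ} (h : (q', u) ∈ M.δ q x y t) :
      Linearized M (some q) t (x.toList.map Sum.inl ++ y.toList.map Sum.inr) (some q')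
        (u.map some ++ if t.isNone then [none] else [])
  | accept {q : Q} (t : Option Γ) (h : q ∈ M.accept) : Linearized M (some q) t [] none []
  | drain (t : Option Γ) : Linearized M none t [] none []

/-- The letters read by the left head. -/
def leftPart (z : List (α ⊕ α)) : List α := z.filterMap Sum.getLeft?

/-- The letters read by the right head, in the order in which they stand in the input. -/
def rightPart (z : List (α ⊕ α)) : List α := (z.filterMap Sum.getRight?).reverse

@[simp] theorem leftPart_append (z z' : List (α ⊕ α)) :
    leftPart (z ++ z') = leftPart z ++ leftPart z' :=
  List.filterMap_append

@[simp] theorem rightPart_append (z z' : List (α ⊕ α)) :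
    rightPart (z ++ z') = rightPart z' ++ rightPart z := by
  simp [rightPart]

theorem leftPart_label (x y : Option α) :
    leftPart (x.toList.map Sum.inl ++ y.toList.map Sum.inr) = x.toList := by
  cases x <;> cases y <;> rfl

theorem rightPart_label (x y : Option α) :
    rightPart (x.toList.map Sum.inl ++ y.toList.map Sum.inr) = y.toList := by
  cases x <;> cases y <;> rfl

theorem length_parts (z : List (α ⊕ α)) :
    (leftPart z).length + (rightPart z).length = z.length := by
  induction z with
  | nil => rfl
  | cons x z ih =>
    cases x <;> simp [leftPart, rightPart, List.filterMap_cons] at ih ⊢ <;> omega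

theorem emptying_drain (M : DHPDA Q α Γ) (s : List (Option Γ)) :
    Emptying M.Linearized none s [] none := by
  induction s with
  | nil => exact .nil none
  | cons t s ih => exact Emptying.step (m := []) (u := []) (Linearized.drain t) ih

theorem exists_emptying {M : DHPDA Q α Γ} {c : Config Q α Γ} {q : Q} {s : List Γ}
    (hq : q ∈ M.accept) (h : Relation.ReflTransGen M.Step c ⟨q, [], s⟩) :
    ∃ z, c.input = leftPart z ++ rightPart z ∧
      Emptying M.Linearized (some c.state) (c.stack.map some ++ [none]) z none := by
  induction h using Relation.ReflTransGen.head_induction_on with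
  | refl =>
    refine ⟨[], rfl, ?_⟩
    cases s with
    | nil => exact Emptying.step (.accept none hq) (emptying_drain M _)
    | cons t s => exact Emptying.step (.accept (some t) hq) (emptying_drain M _)
  | head hs _ ih =>
    obtain ⟨z, hz, hE⟩ := ih
    cases hs with
    | @mk q q' x y w s u ht =>
      simp only at hz hE
      refine ⟨x.toList.map Sum.inl ++ y.toList.map Sum.inr ++ z, ?_, ?_⟩
      · rw [leftPart_append _ z, rightPart_append _ z, leftPart_label, rightPart_label, hz]
        simp only [List.append_assoc]
      · cases s with
        | nil => exact Emptying.step (.move ht) (by simpa using hE)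
        | cons t s => exact Emptying.step (.move ht) (by simpa using hE)

theorem exists_reflTransGen {M : DHPDA Q α Γ} {p : Q} {s : List Γ} {z : List (α ⊕ α)}
    (h : Emptying M.Linearized (some p) (s.map some ++ [none]) z none) :
    ∃ q ∈ M.accept, ∃ s', Relation.ReflTransGen M.Step
      ⟨p, leftPart z ++ rightPart z, s⟩ ⟨q, [], s'⟩ := by
  -- The first conjunct says that the emptying state reads nothing, so the whole input has been
  -- consumed when an accepting state is left for it.
  suffices H : ∀ (p' : Option Q) (S : List (Option Γ)) (z : List (α ⊕ α)),
      Emptying M.Linearized p' S z none →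
      (p' = none → z = []) ∧ ∀ p s, p' = some p → S = s.map some ++ [none] →
        ∃ q ∈ M.accept, ∃ s', Relation.ReflTransGen M.Step
          ⟨p, leftPart z ++ rightPart z, s⟩ ⟨q, [], s'⟩ from
    (H _ _ _ h).2 p s rfl rfl
  intro p' S z h
  refine Emptying.step_induction (motive := fun p' S z => (p' = none → z = []) ∧
    ∀ p s, p' = some p → S = s.map some ++ [none] → ∃ q ∈ M.accept, ∃ s',
      Relation.ReflTransGen M.Step ⟨p, leftPart z ++ rightPart z, s⟩ ⟨q, [], s'⟩) ?_ ?_ h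
  · exact ⟨fun _ => rfl, fun p s h => by cases h⟩
  · intro p₁ p₂ Z u S m w hΔ ih
    cases hΔ with
    | accept _ hq =>
      refine ⟨nofun, fun p s hp hs => ?_⟩
      cases hp
      obtain rfl := ih.1 rfl
      exact ⟨_, hq, s, .refl⟩
    | drain => exact ⟨fun _ => by simpa using ih.1 rfl, fun p s h => by cases h⟩
    | @move q q' x y _ u ht =>
      refine ⟨nofun, fun p s hp hs => ?_⟩
      cases hp
      -- The bottom marker `none` is exactly the argument of `M.δ` for an empty store, and a move on
      -- it puts it back below `u`.
      obtain ⟨rfl, hS⟩ : Z = s.head? ∧ (u.map some ++ if Z.isNone then [none] else []) ++ S =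
          (u ++ s.tail).map some ++ [none] := by
        cases s with
        | nil =>
          obtain ⟨rfl, rfl⟩ := List.cons.inj hs
          simp
        | cons g s =>
          obtain ⟨rfl, rfl⟩ := List.cons.inj hs
          simp
      obtain ⟨q₁, hq₁, s', hr⟩ := ih.2 q' (u ++ s.tail) rfl hS
      refine ⟨q₁, hq₁, s', hr.head ?_⟩
      rw [leftPart_append, rightPart_append, leftPart_label, rightPart_label]
      have := DHPDA.Step.mk (w := leftPart w ++ rightPart w) ht
      simpa only [List.append_assoc] using this

theorem mem_language_iff (M : DHPDA Q α Γ) (w : List α) : w ∈ M.language ↔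
    ∃ z, w = leftPart z ++ rightPart z ∧
      Emptying M.Linearized (some M.start) [none] z none := by
  constructor
  · rintro ⟨q, hq, s, h⟩
    exact exists_emptying hq h
  · rintro ⟨z, rfl, h⟩
    exact exists_reflTransGen (s := []) h

/-- Pumping down for double-head pushdown automata: an accepted word can be shortened by deleting
letters from two factors of bounded length. -/
theorem exists_pump_down [Finite Q] [Finite α] [Finite Γ] (M : DHPDA Q α Γ) :
    ∃ K, ∀ w ∈ M.language, K < w.length → ∃ u₁ v₁ x₁ y₁ z₁ u₂ v₂ x₂ y₂ z₂ : List α,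
      w = u₁ ++ (v₁ ++ x₁ ++ y₁) ++ z₁ ++ (u₂ ++ (v₂ ++ x₂ ++ y₂) ++ z₂) ∧
      (v₁ ++ x₁ ++ y₁).length ≤ K ∧ (v₂ ++ x₂ ++ y₂).length ≤ K ∧
      0 < (v₁ ++ y₁ ++ (v₂ ++ y₂)).length ∧
      u₁ ++ x₁ ++ z₁ ++ (u₂ ++ x₂ ++ z₂) ∈ M.language := by
  have hfin : (⋃ (q : Q) (x : Option α) (y : Option α) (t : Option Γ),
      List.length '' (Prod.snd '' M.δ q x y t)).Finite :=
    Set.finite_iUnion fun q => Set.finite_iUnion fun x => Set.finite_iUnion fun y =>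
      Set.finite_iUnion fun t => ((M.finite_δ q x y t).image _).image _
  obtain ⟨b, hb⟩ := hfin.bddAbove
  have hΔc : ∀ {p Z m p' u}, M.Linearized p Z m p' u → m.length ≤ 2 := by
    intro p Z m p' u h
    cases h with
    | @move _ _ x y => cases x <;> cases y <;> simp
    | accept | drain => simp
  -- The extra one accounts for the restored bottom marker.
  have hΔb : ∀ {p Z m p' u}, M.Linearized p Z m p' u → u.length ≤ b + 1 := by
    intro p Z m p' u h
    cases h with
    | @move q q' x y t u h =>
      have : u.length ≤ b := hb (by
        simp only [Set.mem_iUnion]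
        exact ⟨q, x, y, _, _, ⟨_, h, rfl⟩, rfl⟩)
      split_ifs <;> simp <;> omega
    | accept | drain => simp
  obtain ⟨K, hK⟩ := Emptying.exists_shortens (Δ := M.Linearized) hΔc hΔb
  refine ⟨K, fun w hw hlen => ?_⟩
  obtain ⟨z, rfl, hz⟩ := M.mem_language_iff w |>.1 hw
  rw [List.length_append, length_parts] at hlen
  obtain ⟨u, v, x, y, z, rfl, h1, h2, h3⟩ := hK hz hlen
  -- The right head reads backwards, so in the second half of the input the five pieces occur in
  -- reverse order.
  refine ⟨leftPart u, leftPart v, leftPart x, leftPart y, leftPart z, rightPart z, rightPart y,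
    rightPart x, rightPart v, rightPart u, by simp, ?_, ?_, ?_,
    (M.mem_language_iff _).2 ⟨_, by simp, h3⟩⟩
  all_goals
    have := length_parts v
    have := length_parts x
    have := length_parts y
    simp only [List.length_append] at h1 h2 ⊢
    omega

end DHPDA

/-! ### Five equal blocks cannot be accepted -/

/-- The letter in the block with the given number. -/
def Letter.ofBlock : ℕ → Letter
  | 0 => Letter.a
  | 1 => Letter.b
  | 2 => Letter.c
  | 3 => Letter.d
  | _ => Letter.e

theorem getElem_blockWord {n i : ℕ} (hi : i < (blockWord n n n n n).length) :
    (blockWord n n n n n)[i] = Letter.ofBlock (i / n) := by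
  have hn : 0 < n := by
    rcases Nat.eq_zero_or_pos n with rfl | h
    · simp [blockWord] at hi
    · exact h
  have hi' : i < 5 * n := by
    simp only [blockWord, List.length_append, List.length_replicate] at hi
    omega
  have hlt : i / n < 5 := (Nat.div_lt_iff_lt_mul hn).2 hi'
  have h1 := Nat.div_mul_le_self i n
  have h2 := Nat.lt_div_mul_add hn (a := i)
  simp only [blockWord, List.getElem_append, List.length_append, List.length_replicate,
    List.getElem_replicate]
  generalize i / n = k at *
  interval_cases k <;> simp only [Letter.ofBlock] <;> split_ifs <;> first | rfl | omega

/-- A factor of length at most `n` meets at most two blocks. -/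
theorem exists_two_letters {n : ℕ} {u v w : List Letter} (hv : v.length ≤ n)
    (h : blockWord n n n n n = u ++ v ++ w) : ∃ x y, ∀ l ∈ v, l = x ∨ l = y := by
  -- If the factor starts in the last block, the second index is out of range and defaults to `e`,
  -- which is harmless.
  refine ⟨Letter.ofBlock (u.length / n), Letter.ofBlock (u.length / n + 1), fun l hl => ?_⟩
  obtain ⟨j, hj, rfl⟩ := List.getElem_of_mem hl
  have hn : 0 < n := by omega
  have hlen := congrArg List.length h
  simp only [List.length_append] at hlen
  have hget := getElem_blockWord (n := n) (i := u.length + j) (by omega)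
  simp only [h] at hget
  rw [List.getElem_append_left (by simp; omega), List.getElem_append_right (by omega)] at hget
  simp only [Nat.add_sub_cancel_left] at hget
  rw [hget]
  have h1 : u.length / n ≤ (u.length + j) / n := Nat.div_le_div_right (by omega)
  have h2 : (u.length + j) / n ≤ u.length / n + 1 := by
    rw [← Nat.add_div_right _ hn]
    exact Nat.div_le_div_right (by omega)
  rcases Nat.le_or_eq_of_le_succ h2 with h2 | h2
  · exact Or.inl (by rw [le_antisymm h2 h1])
  · exact Or.inr (by rw [h2])

theorem exists_ne_four (x₁ x₂ x₃ x₄ : Letter) :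
    ∃ l : Letter, l ≠ x₁ ∧ l ≠ x₂ ∧ l ≠ x₃ ∧ l ≠ x₄ := by
  obtain ⟨l, -, hl⟩ := Finset.exists_mem_notMem_of_card_lt_card
    (s := {x₁, x₂, x₃, x₄}) (t := {Letter.a, Letter.b, Letter.c, Letter.d, Letter.e})
    (Finset.card_le_four.trans_lt (by decide))
  exact ⟨l, by simpa using hl⟩

theorem langABCDE_notMem : langABCDE ∉ familyDHPDA Letter := by
  rintro ⟨Q, Γ, hQ, hΓ, M, hM⟩
  obtain ⟨K, hK⟩ := M.exists_pump_down
  rw [hM] at hK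
  obtain ⟨u₁, v₁, x₁, y₁, z₁, u₂, v₂, x₂, y₂, z₂, hw, h₁, h₂, hpos, n, hn, hmem⟩ :=
    -- `K + 1` rather than `K` keeps the exponent positive when `K = 0`.
    hK (blockWord (K + 1) (K + 1) (K + 1) (K + 1) (K + 1)) ⟨K + 1, by omega, rfl⟩
      (by simp [blockWord]; omega)
  obtain ⟨a₁, b₁, hab₁⟩ := exists_two_letters (n := K + 1) (u := u₁)
    (w := z₁ ++ (u₂ ++ (v₂ ++ x₂ ++ y₂) ++ z₂)) (h₁.trans (Nat.le_succ K)) (by simpa using hw)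
  obtain ⟨a₂, b₂, hab₂⟩ := exists_two_letters (n := K + 1)
    (u := u₁ ++ (v₁ ++ x₁ ++ y₁) ++ z₁ ++ u₂) (w := z₂) (h₂.trans (Nat.le_succ K))
    (by simpa using hw)
  obtain ⟨l, hl₁, hl₂, hl₃, hl₄⟩ := exists_ne_four a₁ b₁ a₂ b₂
  have hc₁ : (v₁ ++ x₁ ++ y₁).count l = 0 :=
    List.count_eq_zero.2 fun h => (hab₁ l h).elim hl₁ hl₂
  have hc₂ : (v₂ ++ x₂ ++ y₂).count l = 0 :=
    List.count_eq_zero.2 fun h => (hab₂ l h).elim hl₃ hl₄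
  -- The count of `l` forces `n = K + 1`, whereas the shortened word has length less than `5 * (K +
  -- 1)`.
  have e₁ := congrArg List.length hw
  have e₂ := congrArg List.length hmem
  have e₃ := congrArg (List.count l) hw
  have e₄ := congrArg (List.count l) hmem
  have hcount : ∀ n, (blockWord n n n n n).count l = n := by
    intro n
    rw [blockWord_count]
    cases l <;> rfl
  have hlength : ∀ n, (blockWord n n n n n).length = 5 * n := by
    intro n
    simp only [blockWord, List.length_append, List.length_replicate]
    omega
  rw [hcount] at e₃ e₄
  rw [hlength] at e₁ e₂
  simp only [List.length_append, List.count_append] at *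
  omega

theorem mainTheorem12 :
    ¬ ClosedUnderIntersection familyDIDDHPDA ∧
    ¬ ClosedUnderIntersection familyNIDDHPDA ∧
    langABC ∈ familyDIDDHPDA Letter ∧
    langCDE ∈ familyDIDDHPDA Letter ∧
    langABC ⊓ langCDE = langABCDE ∧
    langABCDE ∉ familyDHPDA Letter := by
  refine ⟨fun h => ?_, fun h => ?_, langABC_mem, langCDE_mem, langABC_inf_langCDE,
    langABCDE_notMem⟩
  · have := h Letter _ _ langABC_mem langCDE_mem
    rw [langABC_inf_langCDE] at this
    exact langABCDE_notMem (familyNIDDHPDA_subset _ (familyDIDDHPDA_subset _ this))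
  · have := h Letter _ _ (familyDIDDHPDA_subset _ langABC_mem)
      (familyDIDDHPDA_subset _ langCDE_mem)
    rw [langABC_inf_langCDE] at this
    exact langABCDE_notMem (familyNIDDHPDA_subset _ this)
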